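/- Let $n\ge 1$ and $m\ge 1$ be integers, $\mu,\lambda>0$, $q\ge 0$ and $r,\theta\ge 0$ be reals. There are $n$ products; the original demand $D_0^{i}(t)$ for product $i$ in period $t$ is independent and identically distributed over all $i$ and $t$, with the scaled Poisson law of $\frac{\mu}{\lambda}Y_\lambda$, where $Y_\gamma$ denotes a Poisson variable with parameter $\gamma$. Under the full $(n,1)$ opaque scheme all demand of a period becomes opaque, and this demand is distributed (divisibly) by the balancing policy on demand: opaque orders are always given to the products with the smallest deviation of demand from the mean, equally in case of a tie. Let $D_1^i(t)$ be the resulting (adjusted) demand for product $i$ in period $t$. Each product is stocked separately and has an $m$-period shelflife. At the start of each period fresh units are ordered, and arrive instantaneously, to bring the total stock to the base-stock level $q$; demand is served first-in-first-out (oldest units first), unmet demand is lost, and units not sold within $m$ periods, the period of arrival included, are discarded. For a fixed product $i$, let $S$ and $W$ be the amounts of lost sales and of discarded units per period and $C=rS+\theta W$ the cost. Denote by $\mathbb E[S],\mathbb E[W],\mathbb E[C]$ the steady-state expected values, i.e. the limits, as $t\to\infty$, of the expected values in period $t$. These limits exist and do not depend on the initial stock (amounts of each age $0,\dots,m-1$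 after ordering, of total $q$). Let $D_1=D_1^i(0)$, $\overline D_1=\frac1m\sum_{t=0}^{m-1}D_1^i(t)$, $s=\lfloor n\lambda q/\mu\rfloor$, and let $F_Y$ and $P_Y$ be the distribution function and the probability mass function of $Y$. Then $$\mathbb E[S]=\mathbb E[D_1-q]^+=(\mu-q)\bigl(1-F_{Y_{n\lambda}}(s)\bigr)+\mu P_{Y_{n\lambda}}(s),$$ $$m\,\mathbb E\Bigl[\frac qm-\overline D_1\Bigr]^+\ \ge\ \mathbb E[W]\ \ge\ \mathbb E\Bigl[\frac qm-\overline D_1\Bigr]^+=\Bigl(\frac qm-\mu\Bigr)F_{Y_{nm\lambda}}(s)+\mu P_{Y_{nm\lambda}}(s),$$ and, with $\overline C_{LB}=r\,\mathbb E[D_1-q]^++\theta\,\mathbb E\bigl[\frac qm-\overline D_1\bigr]^+$, $$\overline C_{LB}\le \mathbb E[C]\le m\,\overline C_{LB}.$$ -/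

import Mathlib

open MeasureTheory ProbabilityTheory Filter Topology
open scoped NNReal

namespace OpaqueInventory

/-- Balancing policy on demand.  Given the mean demands `mean i`, the intermediate demands `X i` of
the `n` non-opaque products and the opaque demand `X0`, the vector `A` of adjusted demands arises by
adding all of `X0` to the `X i`, an opaque (divisible) order only ever going to the products whose
deviation from the mean is smallest, with equal division among ties.  So a product that has received
opaque orders ends up with a smallest final deviation `A i - mean i`. -/
structure IsBPDAllocation {n : ℕ} (mean X : Fin n → ℝ) (X0 : ℝ) (A : Fin n → ℝ) : Prop where
  le : ∀ i, X i ≤ A i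
  sum_eq : ∑ i, A i = ∑ i, X i + X0
  balanced : ∀ i, X i < A i → ∀ j, A i - mean i ≤ A j - mean j

/-- Adjusted demands `A` of one period under the full `(n, 1)` opaque scheme: every customer buys the
opaque product, so all intermediate non-opaque demands vanish, the opaque demand is the total of the
original demands `D₀`, and it is allocated by the balancing policy on demand. -/
def IsFullOpaqueAdjusted {n : ℕ} (mean : Fin n → ℝ) (D₀ A : Fin n → ℝ) : Prop :=
  IsBPDAllocation mean (fun _ => 0) (∑ i, D₀ i) A

/-- Stock at the start of a period, after ordering, for a product with an `m`-period shelflife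
and base-stock level `q`: `x a` is the amount of age `a`, `a = 0, …, m - 1` (age `0` is fresh), and
the total amount is `q`. -/
structure IsStock (m : ℕ) (q : ℝ) (x : ℕ → ℝ) : Prop where
  nonneg : ∀ a, 0 ≤ x a
  eq_zero : ∀ a, m ≤ a → x a = 0
  sum_eq : ∑ a ∈ Finset.range m, x a = q

/-- FIFO issuance: demand `d` is served from the oldest units first.  The amount of age `a` left at
the end of the period is what exceeds the demand not covered by strictly older units. -/
noncomputable def fifoRemaining (m : ℕ) (x : ℕ → ℝ) (d : ℝ) (a : ℕ) : ℝ :=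
  max (x a - max (d - ∑ b ∈ Finset.Ioo a m, x b) 0) 0

/-- Lost sales of a period with starting stock `x` and demand `d`. -/
noncomputable def shortage (m : ℕ) (x : ℕ → ℝ) (d : ℝ) : ℝ :=
  max (d - ∑ a ∈ Finset.range m, x a) 0

/-- Wastage of a period: the units that were in their `m`-th (last) period and were not sold. -/
noncomputable def wastage (m : ℕ) (x : ℕ → ℝ) (d : ℝ) : ℝ :=
  fifoRemaining m x d (m - 1)

/-- Cost of a period, with unit shortage cost `r` and unit wastage cost `θ`. -/
noncomputable def cost (m : ℕ) (r θ : ℝ) (x : ℕ → ℝ) (d : ℝ) : ℝ :=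
  r * shortage m x d + θ * wastage m x d

/-- Stock at the start of the next period: unsold units of age `a < m - 1` get age `a + 1`,
outdated units are discarded, and fresh units are ordered up to the total level `q`. -/
noncomputable def nextStock (m : ℕ) (q : ℝ) (x : ℕ → ℝ) (d : ℝ) : ℕ → ℝ
  | 0 => q - ∑ a ∈ Finset.range (m - 1), fifoRemaining m x d a
  | a + 1 => if a + 1 < m then fifoRemaining m x d a else 0

/-- Stock at the start of period `t`, for initial stock `x₀` and demand sequence `d`. -/
noncomputable def stock (m : ℕ) (q : ℝ) (x₀ : ℕ → ℝ) (d : ℕ → ℝ) : ℕ → ℕ → ℝ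
  | 0 => x₀
  | t + 1 => nextStock m q (stock m q x₀ d t) (d t)

/-- `c` is the (steady-state) expected value per period of the quantity `f x d` that depends on the
starting stock `x` and the demand `d` of a period: whatever the initial stock, the expected
value of the quantity in period `t` exists and tends to `c` as `t → ∞`. -/
def IsSteadyStateMean {Ω : Type*} [MeasurableSpace Ω] (P : Measure Ω) (m : ℕ) (q : ℝ)
    (D : ℕ → Ω → ℝ) (f : (ℕ → ℝ) → ℝ → ℝ) (c : ℝ) : Prop :=
  ∀ x₀ : ℕ → ℝ, IsStock m q x₀ →
    (∀ t, Integrable (fun ω => f (stock m q x₀ (fun s => D s ω) t) (D t ω)) P) ∧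
    Tendsto (fun t => ∫ ω, f (stock m q x₀ (fun s => D s ω) t) (D t ω) ∂P) atTop (𝓝 c)

/-- Law of the scaled Poisson variable `(μ / lam) * Y`, `Y ~ Pois(lam)`. -/
noncomputable def scaledPoisson (μ : ℝ) (lam : ℝ≥0) : Measure ℝ :=
  (poissonMeasure lam).map (fun k : ℕ => μ / lam * k)

/-- Distribution function at `s` of a Poisson variable with parameter `γ`. -/
noncomputable def poissonCDF (γ : ℝ≥0) (s : ℕ) : ℝ :=
  (poissonMeasure γ).real (Set.Iic s)

/-- Probability mass at `s` of a Poisson variable with parameter `γ`. -/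
noncomputable def poissonMass (γ : ℝ≥0) (s : ℕ) : ℝ :=
  (poissonMeasure γ).real {s}

end OpaqueInventory

/-!
When all demand is opaque, balancing gives every product the same share, so the adjusted demand of a
product is the average of `n` independent scaled Poisson variables: the adjusted demands of the
periods are i.i.d. with the law of `c * Y`, where `c = μ / (n * lam)` and `Y` is Poisson with
parameter `n * lam` (`hasLaw_adjusted`). All expectations can thus be computed on the space of
demand paths with the product law `pathLaw` (`IsSteadyStateMean.of_hasLaw`).

*Shortage.* The stock after ordering is always `q`, so the shortage is `max (d - q) 0` in every
period.

*Existence of the steady state.* A demand of at least `q` empties the shelf, after which the stock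
is all fresh, whatever it was before (`stock_eq_of_exists_le`). Scaled Poisson demand reaches `q`
with positive probability. Comparing the inventory in period `k + t` with one restarted afresh in
period `k`, and using that the demand path is invariant in law under shifts, the expected wastages
in periods `k + t` and `t` differ by at most `q * p ^ t`, with `p < 1` the probability that a demand
is below `q`; so they form a Cauchy sequence, whose limit does not depend on the initial stock.

*Bounds on the wastage.* Let `y k` be the total of the ages at least `k` in the `k`-th period of a
window of `m` periods, with demands `d k` and wastages `w k`. FIFO issuance gives the balance
equation `y (k + 1) + w k = max (y k - d k) 0` (`sum_Ico_nextStock_add_wastage`), with `y 0 = q` and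
`y m = 0`. Hence `w (m - 1) ≤ max (q - ∑ d) 0 ≤ ∑ w` over the window. Taking expectations in the
steady state, the mean wastage `W` satisfies `W ≤ E (max (q - ∑ d) 0) ≤ m * W`.

*Closed forms.* They follow by summing the identity `(k + 1) * P (k + 1) = γ * P k` for the Poisson
mass function, and, for the window, from the additivity of Poisson laws.
-/

namespace OpaqueInventory

/-! ### Sample paths of the perishable inventory -/

section Deterministic

variable {m : ℕ} {q : ℝ} {x y : ℕ → ℝ}

lemma fifoRemaining_nonneg (m : ℕ) (x : ℕ → ℝ) (d : ℝ) (a : ℕ) : 0 ≤ fifoRemaining m x d a :=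
  le_max_right _ _

lemma fifoRemaining_le (m : ℕ) {x : ℕ → ℝ} (d : ℝ) {a : ℕ} (hx : 0 ≤ x a) :
    fifoRemaining m x d a ≤ x a :=
  max_le (by linarith [le_max_right (d - ∑ b ∈ Finset.Ioo a m, x b) 0]) hx

lemma wastage_nonneg (m : ℕ) (x : ℕ → ℝ) (d : ℝ) : 0 ≤ wastage m x d :=
  fifoRemaining_nonneg m x d _

lemma IsStock.le (hx : IsStock m q x) (a : ℕ) : x a ≤ q := by
  by_cases h : a < m
  · rw [← hx.sum_eq]
    exact Finset.single_le_sum (fun b _ => hx.nonneg b) (Finset.mem_range.2 h)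
  · rw [hx.eq_zero a (not_lt.1 h), ← hx.sum_eq]
    exact Finset.sum_nonneg fun b _ => hx.nonneg b

lemma IsStock.wastage_le (hx : IsStock m q x) (d : ℝ) : wastage m x d ≤ q :=
  (fifoRemaining_le m d (hx.nonneg _)).trans (hx.le _)

lemma IsStock.shortage_eq (hx : IsStock m q x) (d : ℝ) : shortage m x d = max (d - q) 0 := by
  rw [shortage, hx.sum_eq]

lemma IsStock.nextStock (hm : 1 ≤ m) (hx : IsStock m q x) (d : ℝ) :
    IsStock m q (nextStock m q x d) where
  nonneg a := by
    cases a with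
    | zero =>
      have h1 : ∑ a ∈ Finset.range (m - 1), fifoRemaining m x d a
          ≤ ∑ a ∈ Finset.range (m - 1), x a :=
        Finset.sum_le_sum fun a _ => fifoRemaining_le m d (hx.nonneg a)
      have h2 : ∑ a ∈ Finset.range (m - 1), x a ≤ ∑ a ∈ Finset.range m, x a :=
        Finset.sum_le_sum_of_subset_of_nonneg
          (Finset.range_subset_range.2 (Nat.sub_le m 1)) fun a _ _ => hx.nonneg a
      rw [hx.sum_eq] at h2
      simp only [OpaqueInventory.nextStock]
      linarith
    | succ a =>
      simp only [OpaqueInventory.nextStock]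
      split_ifs
      · exact fifoRemaining_nonneg m x d a
      · exact le_rfl
  eq_zero a ha := by
    cases a with
    | zero => omega
    | succ a => simp [OpaqueInventory.nextStock, not_lt.2 ha]
  sum_eq := by
    obtain ⟨k, rfl⟩ : ∃ k, m = k + 1 := ⟨m - 1, by omega⟩
    rw [Finset.sum_range_succ']
    have : ∑ a ∈ Finset.range k, OpaqueInventory.nextStock (k + 1) q x d (a + 1)
        = ∑ a ∈ Finset.range k, fifoRemaining (k + 1) x d a :=
      Finset.sum_congr rfl fun a ha => by
        simp [OpaqueInventory.nextStock, Finset.mem_range.1 ha]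
    rw [this]
    simp [OpaqueInventory.nextStock]

lemma IsStock.stock (hm : 1 ≤ m) (hx : IsStock m q x) (d : ℕ → ℝ) (t : ℕ) :
    IsStock m q (stock m q x d t) := by
  induction t with
  | zero => exact hx
  | succ t ih => exact ih.nextStock hm (d t)

/-- The stock consisting of `q` fresh units. -/
def freshStock (q : ℝ) : ℕ → ℝ := fun a => if a = 0 then q else 0

lemma isStock_freshStock (hm : 1 ≤ m) (hq : 0 ≤ q) : IsStock m q (freshStock q) where
  nonneg a := by unfold freshStock; split_ifs <;> simp [hq]
  eq_zero a ha := if_neg (by omega)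
  sum_eq := by simp [freshStock, Finset.sum_ite_eq']; omega

lemma stock_add (m : ℕ) (q : ℝ) (x : ℕ → ℝ) (d : ℕ → ℝ) (k t : ℕ) :
    stock m q x d (k + t) = stock m q (stock m q x d k) (fun s => d (k + s)) t := by
  induction t with
  | zero => rfl
  | succ t ih => rw [← add_assoc, stock, ih, stock]

lemma IsStock.fifoRemaining_eq_zero (hx : IsStock m q x) {d : ℝ} (hd : q ≤ d) (a : ℕ) :
    fifoRemaining m x d a = 0 := by
  refine max_eq_right ?_
  by_cases h : a < m
  · have h1 : x a + ∑ b ∈ Finset.Ioo a m, x b = ∑ b ∈ Finset.Ico a m, x b := by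
      rw [← Finset.Ioo_insert_left h, Finset.sum_insert (by simp)]
    have h2 : ∑ b ∈ Finset.Ico a m, x b ≤ ∑ b ∈ Finset.range m, x b :=
      Finset.sum_le_sum_of_subset_of_nonneg
        (fun b hb => Finset.mem_range.2 (Finset.mem_Ico.1 hb).2) fun b _ _ => hx.nonneg b
    rw [hx.sum_eq] at h2
    linarith [le_max_left (d - ∑ b ∈ Finset.Ioo a m, x b) 0]
  · rw [hx.eq_zero a (not_lt.1 h)]
    linarith [le_max_right (d - ∑ b ∈ Finset.Ioo a m, x b) 0]

/-- A demand of at least `q` empties the shelf, so the next stock is all fresh and has forgotten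
the past. -/
lemma IsStock.nextStock_eq_freshStock (hx : IsStock m q x) {d : ℝ} (hd : q ≤ d) :
    OpaqueInventory.nextStock m q x d = freshStock q := by
  funext a
  cases a <;> simp [OpaqueInventory.nextStock, freshStock, hx.fifoRemaining_eq_zero hd]

/-- Coupling: two inventories facing the same demands agree from the first period with demand at
least `q` on. -/
lemma stock_eq_of_exists_le (hm : 1 ≤ m) (hx : IsStock m q x) (hy : IsStock m q y) {d : ℕ → ℝ}
    {t : ℕ} (h : ∃ s < t, q ≤ d s) : stock m q x d t = stock m q y d t := by
  obtain ⟨s, hst, hs⟩ := h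
  obtain ⟨k, rfl⟩ : ∃ k, t = s + 1 + k := ⟨t - (s + 1), by omega⟩
  rw [stock_add, stock_add m q y, stock, stock, (hx.stock hm d s).nextStock_eq_freshStock hs,
    (hy.stock hm d s).nextStock_eq_freshStock hs]

/-- Under FIFO, the units of age at least `a` serve demand before all younger ones, so that their
total only drops by the demand. -/
lemma sum_Ico_fifoRemaining (hx : ∀ a, 0 ≤ x a) {d : ℝ} (hd : 0 ≤ d) {a : ℕ} (ha : a ≤ m) :
    ∑ b ∈ Finset.Ico a m, fifoRemaining m x d b = max (∑ b ∈ Finset.Ico a m, x b - d) 0 := by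
  induction ha using Nat.decreasingInduction with
  | self => simp [hd]
  | of_succ a ha ih =>
    rw [Finset.sum_eq_sum_Ico_succ_bot ha, Finset.sum_eq_sum_Ico_succ_bot ha, ih, fifoRemaining]
    have h1 : Finset.Ioo a m = Finset.Ico (a + 1) m := by ext; simp
    rw [h1]
    have := hx a
    rcases le_total (d - ∑ b ∈ Finset.Ico (a + 1) m, x b) 0 with h | h
    · rw [max_eq_right h, max_eq_left (by linarith), max_eq_left (by linarith),
        max_eq_left (by linarith)]
      ring
    · rw [max_eq_left h, max_eq_right (b := (0 : ℝ)) (a := _ - d) (by linarith), add_zero]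
      congr 1
      ring

/-- Balance equation for the units of age at least `k`: after the demand, they either are
wasted or are found one age class higher in the next period. -/
lemma sum_Ico_nextStock_add_wastage (hx : ∀ a, 0 ≤ x a) {d : ℝ} (hd : 0 ≤ d) {k : ℕ}
    (hk : k < m) :
    ∑ b ∈ Finset.Ico (k + 1) m, nextStock m q x d b + wastage m x d
      = max (∑ b ∈ Finset.Ico k m, x b - d) 0 := by
  rw [← sum_Ico_fifoRemaining hx hd hk.le]
  obtain ⟨l, rfl⟩ : ∃ l, m = l + 1 := ⟨m - 1, by omega⟩
  rw [← Finset.sum_Ico_add' _ k l 1, Finset.sum_Ico_succ_top (a := k) (b := l) (by omega)]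
  congr 1
  refine Finset.sum_congr rfl fun a ha => ?_
  simp [nextStock, (Finset.mem_Ico.1 ha).2]

lemma IsStock.sum_Ico_stock_le (hm : 1 ≤ m) (hx : IsStock m q x) {d : ℕ → ℝ}
    (hd : ∀ t, 0 ≤ d t) {k : ℕ} (hk : k ≤ m) :
    ∑ b ∈ Finset.Ico k m, OpaqueInventory.stock m q x d k b
      ≤ max (q - ∑ t ∈ Finset.range k, d t) 0 := by
  induction k with
  | zero => simp [OpaqueInventory.stock, ← hx.sum_eq]
  | succ k ih =>
    have h := sum_Ico_nextStock_add_wastage (q := q) (hx.stock hm d k).nonneg (hd k)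
      (Nat.lt_of_succ_le hk)
    have hw := wastage_nonneg m (OpaqueInventory.stock m q x d k) (d k)
    have h2 := ih (by omega)
    rw [OpaqueInventory.stock, Finset.sum_range_succ]
    refine (le_add_of_nonneg_right hw).trans (h.trans_le (max_le ?_ (le_max_right _ _)))
    rcases le_total (q - ∑ t ∈ Finset.range k, d t) 0 with h3 | h3
    · rw [max_eq_right h3] at h2
      exact le_max_of_le_right (by linarith [hd k])
    · rw [max_eq_left h3] at h2
      exact le_max_of_le_left (by linarith)

/-- The units wasted at the end of an `m`-period window were on stock at its beginning and have
survived the demand of the whole window. -/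
lemma IsStock.wastage_le_window (hm : 1 ≤ m) (hx : IsStock m q x) {d : ℕ → ℝ}
    (hd : ∀ t, 0 ≤ d t) :
    wastage m (OpaqueInventory.stock m q x d (m - 1)) (d (m - 1))
      ≤ max (q - ∑ t ∈ Finset.range m, d t) 0 := by
  obtain ⟨k, rfl⟩ : ∃ k, m = k + 1 := ⟨m - 1, by omega⟩
  have h := sum_Ico_nextStock_add_wastage (q := q) (hx.stock hm d k).nonneg (hd k) k.lt_succ_self
  have h2 := hx.sum_Ico_stock_le hm hd k.le_succ
  simp only [Nat.succ_eq_add_one, Finset.Ico_self, Finset.sum_empty, zero_add] at h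
  rw [Nat.add_sub_cancel, h, Finset.sum_range_succ]
  refine max_le ?_ (le_max_right _ _)
  rcases le_total (q - ∑ t ∈ Finset.range k, d t) 0 with h3 | h3
  · rw [max_eq_right h3] at h2
    exact le_max_of_le_right (by linarith [hd k])
  · rw [max_eq_left h3] at h2
    exact le_max_of_le_left (by linarith)

/-- All units on stock at the beginning of an `m`-period window have left at its end, by demand or
as waste. -/
lemma IsStock.window_le_sum_wastage (hm : 1 ≤ m) (hx : IsStock m q x) {d : ℕ → ℝ}
    (hd : ∀ t, 0 ≤ d t) :
    max (q - ∑ t ∈ Finset.range m, d t) 0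
      ≤ ∑ t ∈ Finset.range m, wastage m (OpaqueInventory.stock m q x d t) (d t) := by
  refine max_le ?_ (Finset.sum_nonneg fun t _ => wastage_nonneg _ _ _)
  have key : ∀ k ≤ m, q - ∑ t ∈ Finset.range k, d t
      ≤ ∑ b ∈ Finset.Ico k m, OpaqueInventory.stock m q x d k b
        + ∑ t ∈ Finset.range k, wastage m (OpaqueInventory.stock m q x d t) (d t) := by
    intro k hk
    induction k with
    | zero => simp [OpaqueInventory.stock, ← hx.sum_eq]
    | succ k ih =>
      have h := sum_Ico_nextStock_add_wastage (q := q) (hx.stock hm d k).nonneg (hd k)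
        (Nat.lt_of_succ_le hk)
      have h2 := ih (by omega)
      have h3 := le_max_left
        (∑ b ∈ Finset.Ico k m, OpaqueInventory.stock m q x d k b - d k) 0
      rw [OpaqueInventory.stock, Finset.sum_range_succ, Finset.sum_range_succ]
      linarith
  simpa using key m le_rfl

end Deterministic

/-- When all demand is opaque, balancing divides it evenly: a product with more than the least
adjusted demand would have received orders while not having the smallest deviation. -/
lemma IsFullOpaqueAdjusted.eq_average {n : ℕ} {μ : ℝ} {D A : Fin n → ℝ}
    (h : IsFullOpaqueAdjusted (fun _ => μ) D A) (i : Fin n) : A i = (∑ j, D j) / n := by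
  have hle : ∀ j k, A j ≤ A k := by
    intro j k
    by_contra! hlt
    have := h.balanced j ((h.le k).trans_lt hlt) k
    linarith
  have hsum : ∑ j, A j = n * A i := by
    rw [Finset.sum_congr rfl fun j _ => le_antisymm (hle j i) (hle i j)]
    simp
  have hn : (n : ℝ) ≠ 0 := by
    have := i.pos
    positivity
  have h2 := h.sum_eq
  simp only [Finset.sum_const_zero, zero_add] at h2
  rw [eq_div_iff hn, ← h2, hsum, mul_comm]

/-! ### Convergence to the steady state -/

section SteadyState

lemma measurable_fifoRemaining (m a : ℕ) :
    Measurable fun p : (ℕ → ℝ) × ℝ => fifoRemaining m p.1 p.2 a := by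
  unfold fifoRemaining
  fun_prop

lemma measurable_wastage (m : ℕ) : Measurable fun p : (ℕ → ℝ) × ℝ => wastage m p.1 p.2 :=
  measurable_fifoRemaining m _

lemma measurable_shortage (m : ℕ) : Measurable fun p : (ℕ → ℝ) × ℝ => shortage m p.1 p.2 := by
  unfold shortage
  fun_prop

lemma measurable_nextStock (m : ℕ) (q : ℝ) :
    Measurable fun p : (ℕ → ℝ) × ℝ => nextStock m q p.1 p.2 := by
  have h := measurable_fifoRemaining m
  refine measurable_pi_lambda _ fun a => ?_
  cases a with
  | zero => exact measurable_const.sub (Finset.measurable_sum _ fun a _ => h a)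
  | succ a =>
    simp only [nextStock]
    split_ifs
    · exact h a
    · exact measurable_const

lemma measurable_stock (m : ℕ) (q : ℝ) (x : ℕ → ℝ) (t : ℕ) :
    Measurable fun d : ℕ → ℝ => stock m q x d t := by
  induction t with
  | zero => exact measurable_const
  | succ t ih => exact (measurable_nextStock m q).comp (ih.prodMk (measurable_pi_apply t))

/-- Wastage of period `t`, as a function of the demand path. -/
noncomputable def pathWastage (m : ℕ) (q : ℝ) (x : ℕ → ℝ) (t : ℕ) (d : ℕ → ℝ) : ℝ :=
  wastage m (stock m q x d t) (d t)

variable {m : ℕ} {q : ℝ} {x : ℕ → ℝ}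

lemma measurable_pathWastage (m : ℕ) (q : ℝ) (x : ℕ → ℝ) (t : ℕ) :
    Measurable (pathWastage m q x t) :=
  (measurable_wastage m).comp ((measurable_stock m q x t).prodMk (measurable_pi_apply t))

lemma pathWastage_add (m : ℕ) (q : ℝ) (x : ℕ → ℝ) (k t : ℕ) (d : ℕ → ℝ) :
    pathWastage m q x (k + t) d
      = pathWastage m q (stock m q x d k) t (fun s => d (k + s)) := by
  rw [pathWastage, stock_add, pathWastage]

lemma IsStock.abs_pathWastage_sub_le {y : ℕ → ℝ} (hx : IsStock m q x) (hy : IsStock m q y)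
    (hm : 1 ≤ m) (t : ℕ) (d : ℕ → ℝ) :
    |pathWastage m q x t d - pathWastage m q y t d| ≤ q := by
  have h1 := (hx.stock hm d t).wastage_le (d t)
  have h2 := (hy.stock hm d t).wastage_le (d t)
  have h3 := wastage_nonneg m (OpaqueInventory.stock m q x d t) (d t)
  have h4 := wastage_nonneg m (OpaqueInventory.stock m q y d t) (d t)
  rw [pathWastage, pathWastage, abs_le]
  constructor <;> linarith

variable (ν : Measure ℝ) [IsProbabilityMeasure ν]

/-- The law of an i.i.d. demand path with one-period law `ν`. -/
noncomputable abbrev pathLaw : Measure (ℕ → ℝ) := Measure.infinitePi fun _ => ν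

lemma measurePreserving_shift (k : ℕ) :
    MeasurePreserving (fun (d : ℕ → ℝ) s => d (k + s)) (pathLaw ν) (pathLaw ν) where
  measurable := by fun_prop
  map_eq := Measure.map_infinitePi_infinitePi_of_inj (P := fun _ : ℕ => ν) (add_right_injective k)

lemma IsStock.integrable_pathWastage (hm : 1 ≤ m) (hx : IsStock m q x) (t : ℕ) :
    Integrable (pathWastage m q x t) (pathLaw ν) := by
  refine Integrable.of_bound (measurable_pathWastage m q x t).aestronglyMeasurable q
    (Eventually.of_forall fun d => ?_)
  rw [pathWastage, Real.norm_of_nonneg (wastage_nonneg _ _ _)]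
  exact (hx.stock hm d t).wastage_le _

lemma pathLaw_real_forall_lt (q : ℝ) (t : ℕ) :
    (pathLaw ν).real {d | ∀ s < t, d s < q} = ν.real (Set.Iio q) ^ t := by
  have h : {d : ℕ → ℝ | ∀ s < t, d s < q}
      = Set.pi (Finset.range t : Set ℕ) fun _ => Set.Iio q := by
    ext d; simp
  rw [h, measureReal_def, Measure.infinitePi_pi _ fun _ _ => measurableSet_Iio]
  simp [measureReal_def]

/-- Starting the inventory afresh after `k` periods changes the expected wastage `t` periods later
at most by `q` times the probability that none of the demands in between reaches `q`. -/
lemma IsStock.abs_integral_pathWastage_sub_le (hm : 1 ≤ m) (hq : 0 ≤ q) (hx : IsStock m q x)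
    (k t : ℕ) :
    |∫ d, pathWastage m q x (k + t) d ∂(pathLaw ν)
        - ∫ d, pathWastage m q (freshStock q) t d ∂(pathLaw ν)|
      ≤ q * ν.real (Set.Iio q) ^ t := by
  have hf := isStock_freshStock hm hq
  have hshift := measurePreserving_shift ν k
  have hB : MeasurableSet {d : ℕ → ℝ | ∀ s < t, d s < q} := by measurability
  have h1 : ∫ d, pathWastage m q (freshStock q) t d ∂(pathLaw ν)
      = ∫ d, pathWastage m q (freshStock q) t (fun s => d (k + s)) ∂(pathLaw ν) := by
    conv_lhs => rw [← hshift.map_eq]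
    exact integral_map hshift.aemeasurable (measurable_pathWastage _ _ _ _).aestronglyMeasurable
  have hint : Integrable (fun d => pathWastage m q (freshStock q) t (fun s => d (k + s)))
      (pathLaw ν) := hshift.integrable_comp_of_integrable (hf.integrable_pathWastage ν hm t)
  have hB' : MeasurableSet {d : ℕ → ℝ | ∀ s < t, d (k + s) < q} := hshift.measurable hB
  have h2 : (pathLaw ν).real {d | ∀ s < t, d (k + s) < q} = ν.real (Set.Iio q) ^ t := by
    rw [← pathLaw_real_forall_lt ν q t]
    exact hshift.measureReal_preimage hB.nullMeasurableSet
  have h3 : ∫ d, {d : ℕ → ℝ | ∀ s < t, d (k + s) < q}.indicator (fun _ => q) d ∂(pathLaw ν)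
      = q * (pathLaw ν).real {d | ∀ s < t, d (k + s) < q} := by
    rw [integral_indicator_const q hB', smul_eq_mul, mul_comm]
  rw [h1, ← integral_sub (hx.integrable_pathWastage ν hm _) hint, ← h2, ← h3,
    ← Real.norm_eq_abs]
  refine norm_integral_le_of_norm_le ((integrable_const q).indicator hB')
    (Eventually.of_forall fun d => ?_)
  rw [Real.norm_eq_abs, pathWastage_add]
  by_cases hd : ∀ s < t, d (k + s) < q
  · rw [Set.indicator_of_mem (by exact hd)]
    exact (hx.stock hm d k).abs_pathWastage_sub_le hf hm t _
  · rw [Set.indicator_of_notMem (by exact hd), pathWastage, pathWastage,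
      stock_eq_of_exists_le hm (hx.stock hm d k) hf (by push Not at hd; exact hd), sub_self,
      abs_zero]

/-- Unsold rest of the base stock `q` after the demand of the first `m` periods. -/
noncomputable def windowExcess (m : ℕ) (q : ℝ) (d : ℕ → ℝ) : ℝ :=
  max (q - ∑ t ∈ Finset.range m, d t) 0

lemma measurable_windowExcess (m : ℕ) (q : ℝ) : Measurable (windowExcess m q) := by
  unfold windowExcess
  fun_prop

variable {ν}

lemma ae_forall_nonneg (hν : ∀ᵐ y ∂ν, 0 ≤ y) : ∀ᵐ d ∂(pathLaw ν), ∀ t, 0 ≤ d t :=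
  ae_all_iff.2 fun t =>
    (measurePreserving_eval_infinitePi (fun _ : ℕ => ν) t).quasiMeasurePreserving.ae hν

lemma integrable_windowExcess (hq : 0 ≤ q) (hν : ∀ᵐ y ∂ν, 0 ≤ y) :
    Integrable (windowExcess m q) (pathLaw ν) := by
  refine Integrable.of_bound (measurable_windowExcess m q).aestronglyMeasurable q ?_
  filter_upwards [ae_forall_nonneg hν] with d hd
  rw [windowExcess, Real.norm_of_nonneg (le_max_right _ _)]
  exact max_le (by linarith [Finset.sum_nonneg fun t (_ : t ∈ Finset.range m) => hd t]) hq

lemma integral_windowExcess_shift (k : ℕ) :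
    ∫ d, windowExcess m q (fun s => d (k + s)) ∂(pathLaw ν)
      = ∫ d, windowExcess m q d ∂(pathLaw ν) := by
  have hshift := measurePreserving_shift ν k
  conv_rhs => rw [← hshift.map_eq]
  exact (integral_map hshift.aemeasurable
    (measurable_windowExcess m q).aestronglyMeasurable).symm

lemma IsStock.integral_pathWastage_le (hm : 1 ≤ m) (hq : 0 ≤ q) (hx : IsStock m q x)
    (hν : ∀ᵐ y ∂ν, 0 ≤ y) (k : ℕ) :
    ∫ d, pathWastage m q x (k + (m - 1)) d ∂(pathLaw ν)
      ≤ ∫ d, windowExcess m q d ∂(pathLaw ν) := by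
  rw [← integral_windowExcess_shift k]
  refine integral_mono_ae (hx.integrable_pathWastage ν hm _)
    ((measurePreserving_shift ν k).integrable_comp_of_integrable
      (integrable_windowExcess hq hν)) ?_
  filter_upwards [ae_forall_nonneg hν] with d hd
  rw [pathWastage_add]
  exact (hx.stock hm d k).wastage_le_window hm fun s => hd (k + s)

lemma IsStock.le_sum_integral_pathWastage (hm : 1 ≤ m) (hq : 0 ≤ q) (hx : IsStock m q x)
    (hν : ∀ᵐ y ∂ν, 0 ≤ y) (k : ℕ) :
    ∫ d, windowExcess m q d ∂(pathLaw ν)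
      ≤ ∑ t ∈ Finset.range m, ∫ d, pathWastage m q x (k + t) d ∂(pathLaw ν) := by
  rw [← integral_windowExcess_shift k,
    ← integral_finsetSum _ fun t _ => hx.integrable_pathWastage ν hm _]
  refine integral_mono_ae ((measurePreserving_shift ν k).integrable_comp_of_integrable
      (integrable_windowExcess hq hν))
    (integrable_finsetSum _ fun t _ => hx.integrable_pathWastage ν hm _) ?_
  filter_upwards [ae_forall_nonneg hν] with d hd
  simp_rw [pathWastage_add]
  exact (hx.stock hm d k).window_le_sum_wastage hm fun s => hd (k + s)

/-- For i.i.d. nonnegative demands that reach `q` with positive probability, the expected wastage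
has a limit that does not depend on the initial stock, and this limit is between `1 / m` times and
once the expected excess of `q` over the demand of `m` periods. -/
theorem exists_isSteadyStateMean_wastage (hm : 1 ≤ m) (hq : 0 ≤ q) (hν : ∀ᵐ y ∂ν, 0 ≤ y)
    (hlt : ν.real (Set.Iio q) < 1) :
    ∃ w : ℝ, IsSteadyStateMean (pathLaw ν) m q (fun t d => d t) (wastage m) w ∧
      w ≤ ∫ d, windowExcess m q d ∂(pathLaw ν) ∧
      ∫ d, windowExcess m q d ∂(pathLaw ν) ≤ m * w := by
  have hf := isStock_freshStock hm hq
  set g : ℕ → ℝ := fun t => ∫ d, pathWastage m q (freshStock q) t d ∂(pathLaw ν) with hg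
  have hb : Tendsto (fun t : ℕ => q * ν.real (Set.Iio q) ^ t) atTop (𝓝 0) := by
    simpa using (tendsto_pow_atTop_nhds_zero_of_lt_one measureReal_nonneg hlt).const_mul q
  have hcau : CauchySeq g := by
    refine cauchySeq_of_le_tendsto_0' _ (fun t u htu => ?_) hb
    obtain ⟨k, rfl⟩ := Nat.exists_eq_add_of_le' htu
    rw [dist_comm, Real.dist_eq]
    exact hf.abs_integral_pathWastage_sub_le ν hm hq k t
  obtain ⟨w, hw⟩ := cauchySeq_tendsto_of_complete hcau
  refine ⟨w, fun x hx => ⟨hx.integrable_pathWastage ν hm, ?_⟩, ?_, ?_⟩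
  · refine hw.congr_dist (squeeze_zero (fun _ => dist_nonneg) (fun t => ?_) hb)
    rw [dist_comm, Real.dist_eq]
    have := hx.abs_integral_pathWastage_sub_le ν hm hq 0 t
    rwa [zero_add] at this
  · exact le_of_tendsto' (hw.comp (tendsto_add_atTop_nat (m - 1)))
      fun k => hf.integral_pathWastage_le hm hq hν k
  · have hsum : Tendsto (fun k => ∑ t ∈ Finset.range m, g (k + t)) atTop
        (𝓝 (∑ _t ∈ Finset.range m, w)) :=
      tendsto_finsetSum _ fun t _ => hw.comp (tendsto_add_atTop_nat t)
    rw [Finset.sum_const, Finset.card_range, nsmul_eq_mul] at hsum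
    exact ge_of_tendsto' hsum fun k => hf.le_sum_integral_pathWastage hm hq hν k

/-- The stock on hand is `q` in every period, so the lost sales are exactly stationary. -/
theorem isSteadyStateMean_shortage (hm : 1 ≤ m) (hν : Integrable id ν) :
    IsSteadyStateMean (pathLaw ν) m q (fun t d => d t) (shortage m)
      (∫ y, max (y - q) 0 ∂ν) := by
  intro x hx
  have hev := fun t => measurePreserving_eval_infinitePi (fun _ : ℕ => ν) t
  have hmeas : Measurable fun y : ℝ => max (y - q) 0 := by fun_prop
  have hint : Integrable (fun y => max (y - q) 0) ν := (hν.sub (integrable_const q)).pos_part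
  have heq : ∀ t (d : ℕ → ℝ), shortage m (stock m q x d t) (d t) = max (d t - q) 0 :=
    fun t d => (hx.stock hm d t).shortage_eq (d t)
  simp_rw [heq]
  refine ⟨fun t => (hev t).integrable_comp_of_integrable hint, ?_⟩
  have : ∀ t, ∫ d, max (d t - q) 0 ∂(pathLaw ν) = ∫ y, max (y - q) 0 ∂ν := fun t => by
    conv_rhs => rw [← (hev t).map_eq]
    exact (integral_map (hev t).aemeasurable hmeas.aestronglyMeasurable).symm
  simp_rw [this]
  exact tendsto_const_nhds

end SteadyState

/-- Steady-state means only depend on the law of the demand path. -/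
lemma IsSteadyStateMean.of_hasLaw {Ω : Type*} [MeasurableSpace Ω] {P : Measure Ω}
    {ν : Measure ℝ} {m : ℕ} {q : ℝ}
    {D : ℕ → Ω → ℝ} (hD : HasLaw (fun ω t => D t ω) (pathLaw ν) P) {f : (ℕ → ℝ) → ℝ → ℝ}
    (hf : Measurable fun p : (ℕ → ℝ) × ℝ => f p.1 p.2) {c : ℝ}
    (h : IsSteadyStateMean (pathLaw ν) m q (fun t d => d t) f c) :
    IsSteadyStateMean P m q D f c := by
  intro x hx
  obtain ⟨h1, h2⟩ := h x hx
  have hmeas : ∀ t, Measurable fun d : ℕ → ℝ => f (stock m q x d t) (d t) := fun t =>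
    hf.comp ((measurable_stock m q x t).prodMk (measurable_pi_apply t))
  refine ⟨fun t => ?_, h2.congr fun t => ?_⟩
  · have := h1 t
    rw [← hD.map_eq] at this
    exact this.comp_aemeasurable hD.aemeasurable
  · exact (hD.integral_comp (hmeas t).aestronglyMeasurable).symm

lemma IsSteadyStateMean.cost {Ω : Type*} [MeasurableSpace Ω] {P : Measure Ω} {m : ℕ} {q : ℝ}
    {D : ℕ → Ω → ℝ} {a b : ℝ} (r θ : ℝ) (ha : IsSteadyStateMean P m q D (shortage m) a)
    (hb : IsSteadyStateMean P m q D (wastage m) b) :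
    IsSteadyStateMean P m q D (cost m r θ) (r * a + θ * b) := by
  intro x hx
  obtain ⟨ha1, ha2⟩ := ha x hx
  obtain ⟨hb1, hb2⟩ := hb x hx
  refine ⟨fun t => ((ha1 t).const_mul r).add ((hb1 t).const_mul θ), ?_⟩
  refine ((ha2.const_mul r).add (hb2.const_mul θ)).congr fun t => ?_
  rw [← integral_const_mul, ← integral_const_mul,
    ← integral_add ((ha1 t).const_mul r) ((hb1 t).const_mul θ)]
  rfl

/-! ### Scaled Poisson laws -/

section Poisson

/-- Law of `c * Y` for a Poisson variable `Y` with parameter `γ`. -/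
noncomputable def mulPoisson (c : ℝ) (γ : ℝ≥0) : Measure ℝ :=
  (poissonMeasure γ).map fun k : ℕ => c * k

instance (c : ℝ) (γ : ℝ≥0) : IsProbabilityMeasure (mulPoisson c γ) :=
  Measure.isProbabilityMeasure_map .of_discrete

lemma mulPoisson_conv (c : ℝ) (γ δ : ℝ≥0) :
    mulPoisson c γ ∗ mulPoisson c δ = mulPoisson c (γ + δ) := by
  have h := Measure.map_conv_addMonoidHom (μ := poissonMeasure γ) (ν := poissonMeasure δ)
    ((AddMonoidHom.mulLeft c).comp (Nat.castAddMonoidHom ℝ)) (.of_discrete)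
  rw [poissonMeasure_conv_poissonMeasure] at h
  exact h.symm

lemma mulPoisson_zero (c : ℝ) : mulPoisson c 0 = Measure.dirac 0 := by
  have h : poissonMeasure 0 = Measure.dirac 0 := by
    refine Measure.ext_of_singleton fun k => ?_
    cases k <;> simp [poissonMeasure_singleton]
  rw [mulPoisson, h, Measure.map_dirac' .of_discrete]
  simp

/-- Sums of independent scaled Poisson variables are scaled Poisson. -/
lemma hasLaw_sum_mulPoisson {Ω ι : Type*} [MeasurableSpace Ω] {P : Measure Ω}
    [IsProbabilityMeasure P] {X : ι → Ω → ℝ} {c : ℝ} {γ : ℝ≥0}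
    (hX : ∀ i, HasLaw (X i) (mulPoisson c γ) P) (hind : iIndepFun X P) (s : Finset ι) :
    HasLaw (fun ω => ∑ i ∈ s, X i ω) (mulPoisson c (s.card * γ)) P := by
  classical
  induction s using Finset.induction_on with
  | empty =>
    simpa [mulPoisson_zero] using hasLaw_dirac_of_ae_eq (P := P) (X := fun _ => (0 : ℝ)) (by rfl)
  | insert i s hi ih =>
    have h := hind.indepFun_finsetSum_of_notMem₀ (fun j => (hX j).aemeasurable) hi
    have hs : (∑ j ∈ s, X j) = fun ω => ∑ j ∈ s, X j ω := by ext; simp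
    rw [hs] at h
    have := h.hasLaw_fun_add ih (hX i)
    rw [mulPoisson_conv] at this
    simp_rw [Finset.sum_insert hi, Finset.card_insert_of_notMem hi]
    convert! this using 2
    · ring
    · push_cast; ring

lemma mul_poissonMass_succ (γ : ℝ≥0) (k : ℕ) :
    ((k : ℝ) + 1) * poissonMass γ (k + 1) = γ * poissonMass γ k := by
  rw [poissonMass, poissonMass, poissonMeasure_real_singleton, poissonMeasure_real_singleton,
    Nat.factorial_succ]
  push_cast
  field_simp
  ring

lemma hasSum_mul_poissonMass (γ : ℝ≥0) :
    HasSum (fun k : ℕ => (k : ℝ) * poissonMass γ k) γ := by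
  have h1 : HasSum (poissonMass γ) 1 := by
    convert! hasSum_one_poissonMeasure γ using 2 with k
    rw [poissonMass, poissonMeasure_real_singleton]
  rw [← hasSum_nat_add_iff' 1]
  simpa [mul_poissonMass_succ] using h1.mul_left (γ : ℝ)

lemma integrable_natCast_poissonMeasure (γ : ℝ≥0) :
    Integrable (fun k : ℕ => (k : ℝ)) (poissonMeasure γ) := by
  rw [integrable_poissonMeasure_iff]
  refine (hasSum_mul_poissonMass γ).summable.congr fun k => ?_
  rw [poissonMass, poissonMeasure_real_singleton, Real.norm_natCast, mul_comm]

lemma integral_natCast_poissonMeasure (γ : ℝ≥0) : ∫ k : ℕ, (k : ℝ) ∂(poissonMeasure γ) = γ := by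
  refine (hasSum_integral_poissonMeasure (integrable_natCast_poissonMeasure γ)).unique ?_
  convert! hasSum_mul_poissonMass γ using 2 with k
  rw [poissonMass, poissonMeasure_real_singleton, smul_eq_mul, mul_comm]

lemma poissonCDF_eq_sum (γ : ℝ≥0) (s : ℕ) :
    poissonCDF γ s = ∑ k ∈ Finset.range (s + 1), poissonMass γ k := by
  have h : Set.Iic s = (Finset.range (s + 1) : Set ℕ) := by ext; simp
  rw [poissonCDF, h, ← sum_measureReal_singleton]
  rfl

lemma sum_sub_mul_poissonMass (γ : ℝ≥0) (a c : ℝ) (s : ℕ) :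
    ∑ k ∈ Finset.range (s + 1), (a - c * k) * poissonMass γ k
      = (a - c * γ) * poissonCDF γ s + c * γ * poissonMass γ s := by
  rw [poissonCDF_eq_sum]
  induction s with
  | zero => simp; ring
  | succ s ih =>
    rw [Finset.sum_range_succ, ih, Finset.sum_range_succ _ (s + 1)]
    have := mul_poissonMass_succ γ s
    push_cast
    linear_combination (-c) * this

/-- Expected excess of `a` over a scaled Poisson variable: only the values `k ≤ ⌊a / c⌋`
contribute. -/
lemma integral_sub_mul_poissonMeasure (γ : ℝ≥0) {a c : ℝ} (ha : 0 ≤ a) (hc : 0 < c) :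
    ∫ k : ℕ, max (a - c * k) 0 ∂(poissonMeasure γ)
      = (a - c * γ) * poissonCDF γ ⌊a / c⌋₊ + c * γ * poissonMass γ ⌊a / c⌋₊ := by
  rw [← sum_sub_mul_poissonMass, integral_poissonMeasure,
    tsum_eq_sum (s := Finset.range (⌊a / c⌋₊ + 1))]
  · refine Finset.sum_congr rfl fun k hk => ?_
    have h1 : (k : ℝ) ≤ a / c :=
      (Nat.le_floor_iff (by positivity)).1 (Nat.lt_succ_iff.1 (Finset.mem_range.1 hk))
    rw [le_div_iff₀ hc] at h1
    rw [max_eq_left (by linarith), poissonMass, poissonMeasure_real_singleton, smul_eq_mul,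
      mul_comm]
  · intro k hk
    rw [Finset.mem_range, not_lt, Nat.succ_le_iff] at hk
    have h1 : a / c < k := (Nat.floor_lt (by positivity)).1 hk
    rw [div_lt_iff₀ hc] at h1
    rw [max_eq_right (by linarith), smul_zero]

lemma integral_mul_sub_poissonMeasure (γ : ℝ≥0) {a c : ℝ} (ha : 0 ≤ a) (hc : 0 < c) :
    ∫ k : ℕ, max (c * k - a) 0 ∂(poissonMeasure γ)
      = (c * γ - a) * (1 - poissonCDF γ ⌊a / c⌋₊) + c * γ * poissonMass γ ⌊a / c⌋₊ := by
  have h1 : ∀ k : ℕ, max (c * k - a) 0 = (c * k - a) + max (a - c * k) 0 := fun k => by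
    rcases le_total (c * (k : ℝ)) a with h | h
    · rw [max_eq_right (by linarith), max_eq_left (by linarith)]; ring
    · rw [max_eq_left (by linarith), max_eq_right (by linarith)]; ring
  have hY := (integrable_natCast_poissonMeasure γ).const_mul c
  have h2 : Integrable (fun k : ℕ => c * (k : ℝ) - a) (poissonMeasure γ) :=
    hY.sub (integrable_const a)
  have h3 : Integrable (fun k : ℕ => max (a - c * (k : ℝ)) 0) (poissonMeasure γ) :=
    ((integrable_const a).sub hY).pos_part
  simp_rw [h1]
  rw [integral_add h2 h3, integral_sub hY (integrable_const a), integral_const_mul,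
    integral_natCast_poissonMeasure, integral_sub_mul_poissonMeasure γ ha hc]
  simp
  ring

variable {c : ℝ} {γ : ℝ≥0}

lemma ae_nonneg_mulPoisson (hc : 0 ≤ c) : ∀ᵐ y ∂(mulPoisson c γ), 0 ≤ y := by
  rw [mulPoisson, ae_map_iff .of_discrete measurableSet_Ici]
  exact Eventually.of_forall fun k => by positivity

lemma integrable_id_mulPoisson (c : ℝ) (γ : ℝ≥0) : Integrable id (mulPoisson c γ) := by
  rw [mulPoisson, integrable_map_measure aestronglyMeasurable_id .of_discrete]
  exact (integrable_natCast_poissonMeasure γ).const_mul c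

lemma integral_mulPoisson {f : ℝ → ℝ} (hf : Measurable f) :
    ∫ y, f y ∂(mulPoisson c γ) = ∫ k : ℕ, f (c * k) ∂(poissonMeasure γ) :=
  integral_map .of_discrete hf.aestronglyMeasurable

lemma map_div_mulPoisson (a : ℝ) :
    (mulPoisson c γ).map (fun y => y / a) = mulPoisson (c / a) γ := by
  rw [mulPoisson, Measure.map_map (by fun_prop) .of_discrete, mulPoisson]
  congr 1
  ext k
  simp only [Function.comp_apply]
  ring

/-- Scaled Poisson demand is unbounded. -/
lemma mulPoisson_real_Iio_lt_one (hc : 0 < c) (hγ : 0 < γ) (q : ℝ) :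
    (mulPoisson c γ).real (Set.Iio q) < 1 := by
  obtain ⟨k, hk⟩ := exists_nat_gt (q / c)
  rw [div_lt_iff₀ hc] at hk
  have h1 : (poissonMeasure γ).real {k} ≤ (mulPoisson c γ).real (Set.Ici q) := by
    rw [mulPoisson, map_measureReal_apply .of_discrete measurableSet_Ici]
    refine measureReal_mono ?_
    rw [Set.singleton_subset_iff, Set.mem_preimage, Set.mem_Ici]
    linarith
  have h2 := poissonMeasure_real_singleton_pos k hγ
  have h3 := probReal_compl_eq_one_sub (μ := mulPoisson c γ) (measurableSet_Ici (a := q))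
  rw [Set.compl_Ici] at h3
  linarith

end Poisson

/-! ### Adjusted demand under the full opaque scheme -/

lemma hasLaw_average_mulPoisson (n : ℕ) (c : ℝ) (γ : ℝ≥0) :
    (Measure.infinitePi fun _ : Fin n => mulPoisson c γ).map
        (fun x : Fin n → ℝ => (∑ j, x j) / (n : ℝ))
      = mulPoisson (c / n) (n * γ) := by
  have h := hasLaw_sum_mulPoisson (P := Measure.infinitePi fun _ : Fin n => mulPoisson c γ)
    (X := fun j x => x j) (fun j =>
      (measurePreserving_eval_infinitePi (fun _ : Fin n => mulPoisson c γ) j).hasLaw)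
    (iIndepFun_infinitePi (X := fun _ x => x) fun _ => measurable_id) Finset.univ
  rw [Finset.card_univ, Fintype.card_fin] at h
  rw [← map_div_mulPoisson, ← h.map_eq, Measure.map_map (by fun_prop) (by fun_prop)]
  rfl

/-- Under the full opaque scheme the adjusted demands of a product are i.i.d. over the periods,
each being the average of `n` independent original demands. -/
lemma hasLaw_adjusted {Ω : Type*} [MeasurableSpace Ω] {P : Measure Ω} [IsProbabilityMeasure P]
    {n : ℕ} {μ c : ℝ} {γ : ℝ≥0} {D₀ D₁ : ℕ → Fin n → Ω → ℝ}
    (hlaw : ∀ t i, HasLaw (D₀ t i) (mulPoisson c γ) P)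
    (hindep : iIndepFun (fun p : ℕ × Fin n => D₀ p.1 p.2) P)
    (hD₁ : ∀ t, ∀ᵐ ω ∂P, IsFullOpaqueAdjusted (fun _ => μ)
      (fun i => D₀ t i ω) (fun i => D₁ t i ω)) (i : Fin n) :
    HasLaw (fun ω t => D₁ t i ω) (pathLaw (mulPoisson (c / n) (n * γ))) P := by
  -- Group the independent demands by period, then average inside each period.
  have h0 : HasLaw (fun ω (p : ℕ × Fin n) => D₀ p.1 p.2 ω)
      (Measure.infinitePi fun _ : ℕ × Fin n => mulPoisson c γ) P :=
    hindep.hasLaw_infinitePi (fun p => hlaw p.1 p.2)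
      (aemeasurable_pi_lambda _ fun p => (hlaw p.1 p.2).aemeasurable)
  have h1 : MeasurePreserving (MeasurableEquiv.curry ℕ (Fin n) ℝ)
      (Measure.infinitePi fun _ : ℕ × Fin n => mulPoisson c γ)
      (Measure.infinitePi fun _ : ℕ => Measure.infinitePi fun _ : Fin n => mulPoisson c γ) :=
    ⟨by fun_prop, Measure.infinitePi_map_curry fun _ _ => mulPoisson c γ⟩
  have h2 : MeasurePreserving (fun (x : ℕ → Fin n → ℝ) t => (∑ j, x t j) / n)
      (Measure.infinitePi fun _ : ℕ => Measure.infinitePi fun _ : Fin n => mulPoisson c γ)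
      (pathLaw (mulPoisson (c / n) (n * γ))) := by
    refine ⟨by fun_prop, ?_⟩
    rw [Measure.infinitePi_map_pi (f := fun _ (y : Fin n → ℝ) => (∑ j, y j) / (n : ℝ))
      _ fun _ => by fun_prop, hasLaw_average_mulPoisson]
  refine ((h2.comp h1).comp_hasLaw h0).congr ?_
  filter_upwards [ae_all_iff.2 hD₁] with ω hω
  funext t
  exact (hω t).eq_average i

/-- The total demand of `m` periods is again scaled Poisson. -/
lemma integral_windowExcess_mulPoisson (m : ℕ) {q c : ℝ} (γ : ℝ≥0) (hq : 0 ≤ q) (hc : 0 < c) :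
    ∫ d, windowExcess m q d ∂(pathLaw (mulPoisson c γ))
      = (q - c * (m * γ)) * poissonCDF (m * γ) ⌊q / c⌋₊
        + c * (m * γ) * poissonMass (m * γ) ⌊q / c⌋₊ := by
  have h := hasLaw_sum_mulPoisson (P := pathLaw (mulPoisson c γ))
    (X := fun t d => d t) (fun t =>
      (measurePreserving_eval_infinitePi (fun _ : ℕ => mulPoisson c γ) t).hasLaw)
    (iIndepFun_infinitePi (X := fun _ x => x) fun _ => measurable_id) (Finset.range m)
  rw [Finset.card_range] at h
  have hf : Measurable fun y : ℝ => max (q - y) 0 := by fun_prop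
  have h2 := integral_sub_mul_poissonMeasure (m * γ) hq hc
  rw [← integral_mulPoisson hf, ← h.integral_comp hf.aestronglyMeasurable] at h2
  push_cast at h2
  exact h2

end OpaqueInventory

/-! ### Steady-state costs and their bounds -/

theorem proposition2 {Ω : Type*} [MeasurableSpace Ω] (P : Measure Ω) [IsProbabilityMeasure P]
    (n m : ℕ) (hm : 1 ≤ m) (μ : ℝ) (hμ : 0 < μ) (lam : ℝ≥0) (hlam : 0 < lam)
    (q : ℝ) (hq : 0 ≤ q) (r θ : ℝ) (hr : 0 ≤ r) (hθ : 0 ≤ θ)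
    -- `D₀ t i`: original demand for product `i` in period `t`, i.i.d. scaled Poisson
    (D₀ : ℕ → Fin n → Ω → ℝ)
    (hlaw : ∀ t i, HasLaw (D₀ t i) (OpaqueInventory.scaledPoisson μ lam) P)
    (hindep : iIndepFun (fun p : ℕ × Fin n => D₀ p.1 p.2) P)
    -- `D₁ t i`: adjusted demand for product `i` in period `t` under the `(n, 1)` opaque scheme
    (D₁ : ℕ → Fin n → Ω → ℝ)
    (hD₁ : ∀ t, ∀ᵐ ω ∂P, OpaqueInventory.IsFullOpaqueAdjusted (fun _ => μ)
      (fun i => D₀ t i ω) (fun i => D₁ t i ω))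
    (i : Fin n) :
    ∃ ES EW EC : ℝ,
      OpaqueInventory.IsSteadyStateMean P m q (fun t => D₁ t i)
        (OpaqueInventory.shortage m) ES ∧
      OpaqueInventory.IsSteadyStateMean P m q (fun t => D₁ t i)
        (OpaqueInventory.wastage m) EW ∧
      OpaqueInventory.IsSteadyStateMean P m q (fun t => D₁ t i)
        (OpaqueInventory.cost m r θ) EC ∧
      -- `s`: the floor of `n lam q / μ`; `eS`: `E[D₁ - q]⁺`; `eW`: `E[q/m - D̄₁]⁺`
      ∀ (s : ℕ), s = ⌊(n : ℝ) * lam * q / μ⌋₊ →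
      ∀ (eS : ℝ), eS = ∫ ω, max (D₁ 0 i ω - q) 0 ∂P →
      ∀ (eW : ℝ), eW = ∫ ω, max (q / m - (∑ t ∈ Finset.range m, D₁ t i ω) / m) 0 ∂P →
      (ES = eS ∧
        eS = (μ - q) * (1 - OpaqueInventory.poissonCDF (n * lam) s)
          + μ * OpaqueInventory.poissonMass (n * lam) s) ∧
      (eW ≤ EW ∧ EW ≤ m * eW ∧
        eW = (q / m - μ) * OpaqueInventory.poissonCDF (n * m * lam) s
          + μ * OpaqueInventory.poissonMass (n * m * lam) s) ∧
      (r * eS + θ * eW ≤ EC ∧ EC ≤ m * (r * eS + θ * eW)) := by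
  have hn : (0 : ℝ) < n := by exact_mod_cast i.pos
  have hm' : (0 : ℝ) < m := by exact_mod_cast hm
  have hl : (0 : ℝ) < lam := hlam
  -- `c` is the share of one customer's demand that goes to each single product
  set c : ℝ := μ / lam / n with hc_def
  have hc : 0 < c := by positivity
  have hcμ : c * (n * lam) = μ := by rw [hc_def]; field_simp
  have hγ : 0 < (n : ℝ≥0) * lam := mul_pos (by exact_mod_cast i.pos) hlam
  set ν := OpaqueInventory.mulPoisson c (n * lam) with hν
  have hD := OpaqueInventory.hasLaw_adjusted hlaw hindep hD₁ i
  obtain ⟨w, hw, hw1, hw2⟩ := OpaqueInventory.exists_isSteadyStateMean_wastage (ν := ν) hm hq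
    (OpaqueInventory.ae_nonneg_mulPoisson hc.le)
    (OpaqueInventory.mulPoisson_real_Iio_lt_one hc hγ q)
  have hS := (OpaqueInventory.isSteadyStateMean_shortage (q := q) hm
    (OpaqueInventory.integrable_id_mulPoisson c (n * lam))).of_hasLaw hD
      (OpaqueInventory.measurable_shortage m)
  have hW := hw.of_hasLaw hD (OpaqueInventory.measurable_wastage m)
  refine ⟨_, w, _, hS, hW, hS.cost r θ hW, ?_⟩
  intro s hs eS heS eW heW
  have hs' : s = ⌊q / c⌋₊ := by
    rw [hs]
    congr 1
    rw [hc_def]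
    field_simp
  have hmax : Measurable fun y : ℝ => max (y - q) 0 := by fun_prop
  have heS' : eS = ∫ y, max (y - q) 0 ∂ν := by
    rw [heS]
    exact ((measurePreserving_eval_infinitePi (fun _ : ℕ => ν) 0).comp_hasLaw hD).integral_comp
      hmax.aestronglyMeasurable
  -- `eW` is the expected excess of `q` over the window demand, spread over the `m` periods
  have heW' : m * eW = ∫ d, OpaqueInventory.windowExcess m q d ∂(OpaqueInventory.pathLaw ν) := by
    rw [heW, ← hD.integral_comp
      (OpaqueInventory.measurable_windowExcess m q).aestronglyMeasurable, ← integral_const_mul]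
    refine integral_congr_ae (Eventually.of_forall fun ω => ?_)
    simp only [Function.comp_apply, OpaqueInventory.windowExcess]
    rw [← sub_div, mul_max_of_nonneg _ _ hm'.le, mul_zero, mul_div_cancel₀ _ hm'.ne']
  rw [← heW'] at hw1 hw2
  have hw2 : eW ≤ w := le_of_mul_le_mul_left hw2 hm'
  have hform := OpaqueInventory.integral_windowExcess_mulPoisson m (n * lam) hq hc
  rw [← hν, ← heW', ← hs', ← mul_assoc (m : ℝ≥0), mul_comm (m : ℝ≥0) n] at hform
  have hcm : c * (m * ((n * lam : ℝ≥0) : ℝ)) = m * μ := by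
    rw [← hcμ]
    push_cast
    ring
  have heS0 : 0 ≤ eS := by
    rw [heS]
    exact integral_nonneg fun _ => le_max_right _ _
  have hm1 : (1 : ℝ) ≤ m := by exact_mod_cast hm
  refine ⟨⟨heS'.symm, ?_⟩, ⟨hw2, hw1, ?_⟩, ?_, ?_⟩
  · rw [heS', hν, OpaqueInventory.integral_mulPoisson hmax,
      OpaqueInventory.integral_mul_sub_poissonMeasure _ hq hc, ← hs']
    push_cast
    rw [hcμ]
  · refine mul_left_cancel₀ hm'.ne' ?_
    rw [hform, hcm]
    field_simp
  · rw [← heS']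
    gcongr
  · rw [← heS', mul_add]
    have h1 : r * eS ≤ m * (r * eS) := le_mul_of_one_le_left (by positivity) hm1
    have h2 : θ * w ≤ θ * (m * eW) := by gcongr
    linarith
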